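/- Let $N\ge 1$, let $\mathbf n\in\mathbb R^3$ be a unit vector, and let $\hat J_{\mathbf n}=\frac12\sum_{i=1}^N \mathbf n\cdot\hat{\boldsymbol\sigma}^{(i)}$ be the collective angular momentum of $N$ qubits, where $\hat{\boldsymbol\sigma}^{(i)}$ is the vector of Pauli matrices of the $i$th qubit. For a state $\hat\rho=\sum_k\lambda_k|k\rangle\langle k|$ (spectral decomposition) let $$F_Q[\hat\rho,\hat J_{\mathbf n}]=2\sum_{k,l:\,\lambda_k+\lambda_l>0}\frac{(\lambda_k-\lambda_l)^2}{\lambda_k+\lambda_l}\,\bigl|\langle k|\hat J_{\mathbf n}|l\rangle\bigr|^2$$ be its quantum Fisher information. For a partition $\Lambda=\{A_1,\dots,A_{|\Lambda|}\}$ of the $N$ qubits into nonempty disjoint subsets of sizes $N_l=|A_l|$, a state is $\Lambda$-separable if it is of the form $\sum_\gamma p_\gamma\,\hat\rho^{(\gamma)}_{A_1}\otimes\cdots\otimes\hat\rho^{(\gamma)}_{A_{|\Lambda|}}$ with a probability distribution $p_\gamma$ and states $\hat\rho^{(\gamma)}_{A_l}$ of the qubits in $A_l$. For an integer $r\ge-(N-1)$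 let $\mathcal L_{r}=\{\Lambda : \max_l N_l-|\Lambda|\le r\}$ be the set of partitions with Dyson's rank at most $r$; a state has Dyson's rank at most $r$ if it is a mixture $\sum_{\Lambda\in\mathcal L_r}P_\Lambda\hat\rho_\Lambda$ of $\Lambda$-separable states $\hat\rho_\Lambda$, with $P_\Lambda$ a probability distribution. Put $$f^{\nwsearrow}_N(r)=\max_{\Lambda\in\mathcal L_r}\sum_{l=1}^{|\Lambda|}N_l^2 .$$ Then $$\max_{\hat\rho}F_Q[\hat\rho,\hat J_{\mathbf n}]=f^{\nwsearrow}_N(r),$$ where the maximum is over all states $\hat\rho$ with Dyson's rank at most $r$ and is attained. Moreover, every state $\hat\rho$ with Dyson's rank at most $r$ satisfies $$F_Q[\hat\rho,\hat J_{\mathbf n}]\le\frac{(N+r)^2}{4}-\frac14+N\quad\text{if } r\ne 4-N,\qquad F_Q[\hat\rho,\hat J_{\mathbf n}]\le N+4\quad\text{if } r=4-N .$$ -/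

import Mathlib

open scoped BigOperators ComplexOrder

noncomputable section

/-- The operators on the Hilbert space of the qubits labelled by `ι`, that is, on the tensor
product of one copy of `ℂ²` for every `i : ι`, as matrices in the product basis; a basis vector
is a map `ι → Fin 2` (`0` for spin up, `1` for spin down). -/
abbrev QubitOp (ι : Type) : Type := Matrix (ι → Fin 2) (ι → Fin 2) ℂ

/-- A quantum state, i.e. a density matrix: positive semidefinite with trace one. -/
def IsDensityMatrix {κ : Type} [Fintype κ] (ρ : Matrix κ κ ℂ) : Prop :=
  ρ.PosSemidef ∧ ρ.trace = 1

/-- The Pauli matrices `σ_x, σ_y, σ_z`. -/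
def pauli : Fin 3 → Matrix (Fin 2) (Fin 2) ℂ :=
  ![!![0, 1; 1, 0], !![0, -Complex.I; Complex.I, 0], !![1, 0; 0, -1]]

/-- The single-qubit operator `A` acting on the `i`-th of `N` qubits, `1 ⊗ ⋯ ⊗ A ⊗ ⋯ ⊗ 1`. -/
def siteOp {N : ℕ} (i : Fin N) (A : Matrix (Fin 2) (Fin 2) ℂ) : QubitOp (Fin N) :=
  Matrix.of fun x y => ∏ j, (if j = i then A else 1) (x j) (y j)

/-- The collective angular momentum `J_n = ∑ᵢ n·σ⁽ⁱ⁾ / 2` in the direction `n`. -/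
def collectiveSpin (N : ℕ) (n : EuclideanSpace ℝ (Fin 3)) : QubitOp (Fin N) :=
  ∑ i : Fin N, ∑ a : Fin 3, ((n a / 2 : ℝ) : ℂ) • siteOp i (pauli a)

open Classical in
/-- The quantum Fisher information `F_Q[ρ, H]` of the state `ρ` for the phase `θ` imprinted by
`ρ ↦ exp(-iHθ) ρ exp(iHθ)`:
`F_Q[ρ, H] = 2 ∑_{k,l} (λ_k - λ_l)² / (λ_k + λ_l) |⟨k|H|l⟩|²`,
where `ρ = ∑_k λ_k |k⟩⟨k|` is the spectral decomposition and the sum is over the pairs with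
`λ_k + λ_l > 0` (for a state, `λ_k + λ_l = 0` forces `λ_k = λ_l = 0`).
The value `0` for matrices that are not Hermitian is never used for a state. -/
def qfi {κ : Type} [Fintype κ] (ρ H : Matrix κ κ ℂ) : ℝ :=
  if hρ : ρ.IsHermitian then
    2 * ∑ k, ∑ l, if 0 < hρ.eigenvalues k + hρ.eigenvalues l then
        (hρ.eigenvalues k - hρ.eigenvalues l) ^ 2 / (hρ.eigenvalues k + hρ.eigenvalues l) *
          ‖(star (hρ.eigenvectorUnitary : Matrix κ κ ℂ) * H *
            (hρ.eigenvectorUnitary : Matrix κ κ ℂ)) k l‖ ^ 2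
      else 0
  else 0

/-- A partition of the `N` qubits into nonempty, disjoint subsets. -/
abbrev QubitPartition (N : ℕ) : Type := Finpartition (Finset.univ : Finset (Fin N))

/-- The tensor product over the subsets `A` of the partition `Λ` of the operators `σ A` on the
qubits in `A`. -/
def partitionTensor {N : ℕ} (Λ : QubitPartition N) (σ : (A : Finset (Fin N)) → QubitOp A) :
    QubitOp (Fin N) :=
  Matrix.of fun x y => ∏ A ∈ Λ.parts, σ A (fun i => x i) (fun i => y i)

/-- `ρ` is `Λ`-separable: a finite mixture of tensor products of states of the subsets in `Λ`. -/
def IsPartitionSeparable {N : ℕ} (Λ : QubitPartition N) (ρ : QubitOp (Fin N)) : Prop :=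
  ∃ (m : ℕ) (p : Fin m → ℝ) (σ : Fin m → (A : Finset (Fin N)) → QubitOp A),
    (∀ γ, 0 ≤ p γ) ∧ ∑ γ, p γ = 1 ∧
    (∀ γ, ∀ A ∈ Λ.parts, IsDensityMatrix (σ γ A)) ∧
    ρ = ∑ γ, (p γ : ℂ) • partitionTensor Λ (σ γ)

/-- The width `w = max Λ` of a partition: the size of its largest subset. -/
def partitionWidth {N : ℕ} (Λ : QubitPartition N) : ℕ := Λ.parts.sup Finset.card

/-- The height `h = |Λ|` of a partition: the number of its subsets. -/
def partitionHeight {N : ℕ} (Λ : QubitPartition N) : ℕ := Λ.parts.card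

/-- Dyson's rank `w - h` of a partition. -/
def dysonRank {N : ℕ} (Λ : QubitPartition N) : ℤ :=
  (partitionWidth Λ : ℤ) - (partitionHeight Λ : ℤ)

/-- The set of the partitions of `N` qubits with Dyson's rank at most `r`. -/
def rankPartitions (N : ℕ) (r : ℤ) : Finset (QubitPartition N) :=
  Finset.univ.filter fun Λ => dysonRank Λ ≤ r

/-- `ρ` is a state with Dyson's rank not larger than `r`: a mixture of `Λ`-separable states, over
the partitions `Λ` with Dyson's rank at most `r`. -/
def HasDysonRankLE {N : ℕ} (r : ℤ) (ρ : QubitOp (Fin N)) : Prop :=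
  ∃ (P : QubitPartition N → ℝ) (τ : QubitPartition N → QubitOp (Fin N)),
    (∀ Λ ∈ rankPartitions N r, 0 ≤ P Λ) ∧ ∑ Λ ∈ rankPartitions N r, P Λ = 1 ∧
    (∀ Λ ∈ rankPartitions N r, IsPartitionSeparable Λ (τ Λ)) ∧
    ρ = ∑ Λ ∈ rankPartitions N r, (P Λ : ℂ) • τ Λ

/-- The maximum of `∑_l N_l²` over the partitions with Dyson's rank at most `r`, where the `N_l`
are the sizes of the subsets (there is such a partition as soon as `r ≥ -(N - 1)`). -/
def rankBound (N : ℕ) (r : ℤ) : ℕ :=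
  (rankPartitions N r).sup fun Λ => ∑ A ∈ Λ.parts, A.card ^ 2

end

/-! The quantum Fisher information is the maximum over Hermitian `X` of Re Tr ρ(2i[H, X] - X²)
(`sldForm_le_qfi`, `exists_sldForm_eq_qfi`). For fixed `X` this is linear in ρ, so bounds pass from
product states to mixtures without a separate convexity theorem.

Completing a square bounds the functional by four times the variance of `H`
(`sldForm_le_expval_sq`). For a product state, the variance of the collective spin is a sum of
covariances, which vanish across blocks and are at most 1/4 within a block (`covariance_le`).
Counting pairs inside blocks gives ∑ N_l².

A product of GHZ states along `n` has zero means and correlations exactly 1/4 inside blocks. It is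
pure, so its Fisher information reaches ∑ N_l² (`exists_separable_qfi_ge`).

The closed bound is integer arithmetic on the excesses N_l - 1 (`sum_card_sq_le_aux`): an AM-GM
estimate improved by integrality, which fails only for the sizes 2, 2, 1, …, 1, whence the
exceptional rank 4 - N. -/

open Matrix

noncomputable section

/-! ### Variational formula for the quantum Fisher information -/

section Variational

variable {κ : Type} [Fintype κ]

/-- The real part of the expectation value `Tr(ρ M)`. -/
def expval (ρ M : Matrix κ κ ℂ) : ℝ := (ρ * M).trace.re

lemma expval_add (ρ M M' : Matrix κ κ ℂ) : expval ρ (M + M') = expval ρ M + expval ρ M' := by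
  simp [expval, Matrix.mul_add]

lemma expval_sub (ρ M M' : Matrix κ κ ℂ) : expval ρ (M - M') = expval ρ M - expval ρ M' := by
  simp [expval, Matrix.mul_sub]

lemma expval_real_smul (ρ M : Matrix κ κ ℂ) (c : ℝ) :
    expval ρ ((c : ℂ) • M) = c * expval ρ M := by
  simp [expval]

lemma expval_sum {ι : Type*} (s : Finset ι) (ρ : Matrix κ κ ℂ) (M : ι → Matrix κ κ ℂ) :
    expval ρ (∑ i ∈ s, M i) = ∑ i ∈ s, expval ρ (M i) := by
  simp [expval, Matrix.mul_sum, Matrix.trace_sum]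

lemma expval_sum_smul_state {ι : Type*} (s : Finset ι) (p : ι → ℝ) (ρ : ι → Matrix κ κ ℂ)
    (M : Matrix κ κ ℂ) :
    expval (∑ i ∈ s, (p i : ℂ) • ρ i) M = ∑ i ∈ s, p i * expval (ρ i) M := by
  simp [expval, Matrix.sum_mul, Matrix.trace_sum]

lemma expval_star_mul_self_nonneg {ρ : Matrix κ κ ℂ} (hρ : ρ.PosSemidef) (M : Matrix κ κ ℂ) :
    0 ≤ expval ρ (Mᴴ * M) := by
  have h := (hρ.mul_mul_conjTranspose_same M).trace_nonneg
  rw [Matrix.mul_assoc, Matrix.trace_mul_comm, Matrix.mul_assoc] at h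
  exact (Complex.le_def.1 h).1

/-- The functional of `X` whose maximum over the Hermitian matrices is the quantum Fisher
information. -/
def sldForm (ρ H X : Matrix κ κ ℂ) : ℝ :=
  expval ρ ((2 * Complex.I) • (H * X - X * H) - X * X)

/-- The summand of `sldForm` in the eigenbasis of the state. -/
def sldTerm (a b : ℝ) (h x : ℂ) : ℝ :=
  -2 * (a - b) * (h * star x).im - (a + b) / 2 * ‖x‖ ^ 2

lemma sldForm_diagonal [DecidableEq κ] (d : κ → ℝ) {H X : Matrix κ κ ℂ} (hH : H.IsHermitian)
    (hX : X.IsHermitian) :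
    sldForm (diagonal fun k => (d k : ℂ)) H X =
      ∑ k, ∑ l, sldTerm (d k) (d l) (H k l) (X k l) := by
  have hHs : ∀ k l, H l k = star (H k l) := fun k l => (hH.apply l k).symm
  have hXs : ∀ k l, X l k = star (X k l) := fun k l => (hX.apply l k).symm
  have h1 : sldForm (diagonal fun k => (d k : ℂ)) H X =
      ∑ k, ∑ l, d k * (-4 * (H k l * star (X k l)).im - ‖X k l‖ ^ 2) := by
    rw [sldForm, expval, Matrix.trace, Complex.re_sum]
    refine Finset.sum_congr rfl fun k _ => ?_
    rw [Matrix.diag_apply, Matrix.diagonal_mul, Matrix.sub_apply, Matrix.smul_apply,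
      Matrix.sub_apply, Matrix.mul_apply, Matrix.mul_apply, Matrix.mul_apply,
      ← Finset.sum_sub_distrib, ← Finset.mul_sum, smul_eq_mul, Finset.mul_sum,
      ← Finset.sum_sub_distrib, Complex.re_ofReal_mul, Complex.re_sum]
    congr 1
    refine Finset.sum_congr rfl fun l _ => ?_
    rw [hHs k l, hXs k l, ← Complex.normSq_eq_norm_sq]
    simp [Complex.normSq_apply]
    ring
  -- Swapping `k` and `l` conjugates both entries and flips the imaginary part; averaging the two
  -- forms yields the symmetric summand `sldTerm`.
  have h2 : ∑ k, ∑ l, d k * (-4 * (H k l * star (X k l)).im - ‖X k l‖ ^ 2) =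
      ∑ k, ∑ l, d l * (4 * (H k l * star (X k l)).im - ‖X k l‖ ^ 2) := by
    rw [Finset.sum_comm]
    refine Finset.sum_congr rfl fun k _ => Finset.sum_congr rfl fun l _ => ?_
    have : (star (H k l) * star (star (X k l))).im = -(H k l * star (X k l)).im := by
      rw [← star_mul', RCLike.star_def, Complex.conj_im]
    rw [hHs k l, hXs k l, norm_star, this]
    ring
  have h3 : ∑ k, ∑ l, sldTerm (d k) (d l) (H k l) (X k l) =
      (∑ k, ∑ l, d k * (-4 * (H k l * star (X k l)).im - ‖X k l‖ ^ 2)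
        + ∑ k, ∑ l, d l * (4 * (H k l * star (X k l)).im - ‖X k l‖ ^ 2)) / 2 := by
    simp only [← Finset.sum_add_distrib, Finset.sum_div]
    refine Finset.sum_congr rfl fun k _ => Finset.sum_congr rfl fun l _ => ?_
    unfold sldTerm
    ring
  rw [h3, ← h2, h1]
  ring

lemma sldForm_conj [DecidableEq κ] {U : Matrix κ κ ℂ} (hU : U * star U = 1)
    (D H X : Matrix κ κ ℂ) :
    sldForm (U * D * star U) H X = sldForm D (star U * H * U) (star U * X * U) := by
  have e : ∀ A B : Matrix κ κ ℂ,
      star U * A * U * (star U * B * U) = star U * (A * B) * U := by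
    intro A B
    calc _ = star U * A * (U * star U) * B * U := by simp only [Matrix.mul_assoc]
      _ = _ := by rw [hU]; simp only [Matrix.mul_assoc, Matrix.one_mul]
  unfold sldForm expval
  rw [e, e, e, ← Matrix.sub_mul, ← Matrix.mul_sub, ← Matrix.smul_mul, ← Matrix.mul_smul,
    ← Matrix.sub_mul, ← Matrix.mul_sub]
  generalize (2 * Complex.I) • (H * X - X * H) - X * X = M
  congr 1
  rw [Matrix.mul_assoc, Matrix.trace_mul_comm, ← Matrix.mul_assoc, Matrix.trace_mul_comm,
    Matrix.mul_assoc]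

/-- Cauchy-Schwarz on the imaginary part leaves a concave quadratic in ‖x‖, whose maximum is found
by completing the square. -/
lemma sldTerm_le {a b : ℝ} (ha : 0 ≤ a) (hb : 0 ≤ b) (h x : ℂ) :
    sldTerm a b h x ≤
      2 * if 0 < a + b then (a - b) ^ 2 / (a + b) * ‖h‖ ^ 2 else 0 := by
  unfold sldTerm
  have him : |(h * star x).im| ≤ ‖h‖ * ‖x‖ := by
    simpa using Complex.abs_im_le_norm (h * star x)
  split_ifs with hs
  · have h1 : -2 * (a - b) * (h * star x).im ≤ 2 * (|a - b| * (‖h‖ * ‖x‖)) := by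
      have : |(a - b) * (h * star x).im| ≤ |a - b| * (‖h‖ * ‖x‖) := by
        rw [abs_mul]; gcongr
      linarith [neg_le_of_abs_le this]
    rw [← sq_abs (a - b)]
    generalize |a - b| = d at *
    have h2 : 2 * (d ^ 2 / (a + b) * ‖h‖ ^ 2) - 2 * (d * (‖h‖ * ‖x‖)) + (a + b) / 2 * ‖x‖ ^ 2
        = (2 * d * ‖h‖ - (a + b) * ‖x‖) ^ 2 / (2 * (a + b)) := by
      field_simp
      ring
    have h3 : 0 ≤ (2 * d * ‖h‖ - (a + b) * ‖x‖) ^ 2 / (2 * (a + b)) := by positivity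
    linarith
  · obtain rfl : a = 0 := by linarith
    obtain rfl : b = 0 := by linarith
    simp

/-- The maximizer is the matrix entry of the symmetric logarithmic derivative. If a = b = 0 the
quotient is 0 by convention, and both sides vanish. -/
lemma sldTerm_optimal {a b : ℝ} (ha : 0 ≤ a) (hb : 0 ≤ b) (h : ℂ) :
    sldTerm a b h ((2 * (a - b) / (a + b) : ℝ) * Complex.I * h) =
      2 * if 0 < a + b then (a - b) ^ 2 / (a + b) * ‖h‖ ^ 2 else 0 := by
  unfold sldTerm
  split_ifs with hs
  · have e : (h * star (((2 * (a - b) / (a + b) : ℝ) : ℂ) * Complex.I * h)).im =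
        -(2 * (a - b) / (a + b)) * ‖h‖ ^ 2 := by
      rw [← Complex.normSq_eq_norm_sq, Complex.normSq_apply]
      simp only [star_mul', RCLike.star_def, Complex.conj_ofReal, Complex.conj_I, Complex.mul_im,
        Complex.mul_re, Complex.ofReal_re, Complex.ofReal_im, Complex.neg_re, Complex.neg_im,
        Complex.I_re, Complex.I_im, Complex.conj_re, Complex.conj_im]
      ring
    rw [e, norm_mul, norm_mul, Complex.norm_I, Complex.norm_real, Real.norm_eq_abs, mul_one,
      mul_pow, sq_abs]
    field_simp
    ring
  · obtain rfl : a = 0 := by linarith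
    obtain rfl : b = 0 := by linarith
    simp

open Classical in
lemma qfi_eq_sum {ρ : Matrix κ κ ℂ} (hρ : ρ.IsHermitian) (H : Matrix κ κ ℂ) :
    qfi ρ H = ∑ k, ∑ l, 2 * if 0 < hρ.eigenvalues k + hρ.eigenvalues l then
        (hρ.eigenvalues k - hρ.eigenvalues l) ^ 2 / (hρ.eigenvalues k + hρ.eigenvalues l) *
          ‖(star (hρ.eigenvectorUnitary : Matrix κ κ ℂ) * H *
            (hρ.eigenvectorUnitary : Matrix κ κ ℂ)) k l‖ ^ 2
      else 0 := by
  rw [qfi, dif_pos hρ]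
  simp only [Finset.mul_sum]

open Classical in
lemma sldForm_eq_sum {ρ H X : Matrix κ κ ℂ} (hρ : ρ.IsHermitian) (hH : H.IsHermitian)
    (hX : X.IsHermitian) :
    sldForm ρ H X = ∑ k, ∑ l, sldTerm (hρ.eigenvalues k) (hρ.eigenvalues l)
      ((star (hρ.eigenvectorUnitary : Matrix κ κ ℂ) * H *
            (hρ.eigenvectorUnitary : Matrix κ κ ℂ)) k l)
      ((star (hρ.eigenvectorUnitary : Matrix κ κ ℂ) * X *
            (hρ.eigenvectorUnitary : Matrix κ κ ℂ)) k l) := by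
  conv_lhs => rw [hρ.spectral_theorem, Unitary.conjStarAlgAut_apply]
  rw [sldForm_conj (Unitary.coe_mul_star_self _)]
  exact sldForm_diagonal _ (Matrix.isHermitian_conjTranspose_mul_mul _ hH)
    (Matrix.isHermitian_conjTranspose_mul_mul _ hX)

lemma sldForm_le_qfi {ρ H X : Matrix κ κ ℂ} (hρ : ρ.PosSemidef) (hH : H.IsHermitian)
    (hX : X.IsHermitian) : sldForm ρ H X ≤ qfi ρ H := by
  classical
  rw [sldForm_eq_sum hρ.1 hH hX, qfi_eq_sum hρ.1]
  exact Finset.sum_le_sum fun k _ => Finset.sum_le_sum fun l _ =>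
    sldTerm_le (hρ.eigenvalues_nonneg k) (hρ.eigenvalues_nonneg l) _ _

lemma exists_sldForm_eq_qfi {ρ H : Matrix κ κ ℂ} (hρ : ρ.PosSemidef) (hH : H.IsHermitian) :
    ∃ X : Matrix κ κ ℂ, X.IsHermitian ∧ sldForm ρ H X = qfi ρ H := by
  classical
  set U := (hρ.1.eigenvectorUnitary : Matrix κ κ ℂ) with hU
  have hUU : star U * U = 1 := Unitary.coe_star_mul_self _
  set d := hρ.1.eigenvalues with hd
  set H' := star U * H * U with hH'
  have hH'h : H'.IsHermitian := Matrix.isHermitian_conjTranspose_mul_mul _ hH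
  let Y : Matrix κ κ ℂ := Matrix.of fun k l =>
    ((2 * (d k - d l) / (d k + d l) : ℝ) : ℂ) * Complex.I * H' k l
  -- The real coefficient is antisymmetric in `k`, `l`, and the factor i compensates the sign.
  have hY : Y.IsHermitian := by
    refine Matrix.IsHermitian.ext fun k l => ?_
    simp only [Y, Matrix.of_apply]
    rw [star_mul', star_mul', hH'h.apply]
    simp only [RCLike.star_def, Complex.conj_ofReal, Complex.conj_I]
    rw [← neg_sub (d k) (d l), add_comm (d l)]
    push_cast
    ring
  have hX : (U * Y * star U).IsHermitian := Matrix.isHermitian_mul_mul_conjTranspose _ hY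
  refine ⟨U * Y * star U, hX, ?_⟩
  rw [sldForm_eq_sum hρ.1 hH hX, qfi_eq_sum hρ.1]
  have e : star U * (U * Y * star U) * U = Y := by
    calc _ = (star U * U) * Y * (star U * U) := by simp only [Matrix.mul_assoc]
      _ = _ := by rw [hUU, Matrix.one_mul, Matrix.mul_one]
  rw [← hU, e]
  refine Finset.sum_congr rfl fun k _ => Finset.sum_congr rfl fun l _ => ?_
  exact sldTerm_optimal (hρ.eigenvalues_nonneg k) (hρ.eigenvalues_nonneg l) _

/-- The quantum Fisher information is at most four times the variance, at the level of the
variational functional. -/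
lemma sldForm_le_expval_sq [DecidableEq κ] {ρ H X : Matrix κ κ ℂ} (hρ : ρ.PosSemidef)
    (hH : H.IsHermitian) (hX : X.IsHermitian) (c : ℝ) :
    sldForm ρ H X ≤ 4 * expval ρ ((H - (c : ℂ) • 1) * (H - (c : ℂ) • 1)) := by
  set K := H - (c : ℂ) • (1 : Matrix κ κ ℂ) with hK
  have hKh : Kᴴ = K := by
    rw [hK, Matrix.conjTranspose_sub, hH.eq, Matrix.conjTranspose_smul]
    simp
  -- Expanding this square gives 4K² minus the operator in `sldForm`; the shift by `c` drops out of
  -- the commutator.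
  have h := expval_star_mul_self_nonneg hρ (X + (2 * Complex.I) • K)
  have e : (X + (2 * Complex.I) • K)ᴴ * (X + (2 * Complex.I) • K) =
      ((4 : ℝ) : ℂ) • (K * K) - ((2 * Complex.I) • (H * X - X * H) - X * X) := by
    have hc : H * X - X * H = K * X - X * K := by
      simp [hK, Matrix.sub_mul, Matrix.mul_sub]
    rw [hc, Matrix.conjTranspose_add, Matrix.conjTranspose_smul, hKh, hX.eq]
    simp only [Matrix.add_mul, Matrix.mul_add, smul_mul_assoc, mul_smul_comm, smul_sub]
    have : star (2 * Complex.I) = -(2 * Complex.I) := by simp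
    rw [this]
    have h4 : 2 * Complex.I * (2 * Complex.I) = -((4 : ℝ) : ℂ) := by
      push_cast
      linear_combination 4 * Complex.I_mul_I
    simp only [neg_smul, smul_neg, smul_add, smul_smul, h4]
    abel
  rw [e, expval_sub, expval_real_smul] at h
  unfold sldForm
  linarith

end Variational

/-! ### Tensor products of single-qubit operators and vectors -/

section Tensor

/-- The tensor product of single-qubit operators. -/
def tensorOp {ι : Type} [Fintype ι] (M : ι → Matrix (Fin 2) (Fin 2) ℂ) : QubitOp ι :=
  Matrix.of fun x y => ∏ j, M j (x j) (y j)

/-- The tensor product of single-qubit vectors. -/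
def tensorVec {ι : Type} [Fintype ι] (w : ι → Fin 2 → ℂ) : (ι → Fin 2) → ℂ :=
  fun x => ∏ j, w j (x j)

variable {ι : Type} [Fintype ι]

lemma tensorOp_mul [DecidableEq ι] (M M' : ι → Matrix (Fin 2) (Fin 2) ℂ) :
    tensorOp M * tensorOp M' = tensorOp fun j => M j * M' j := by
  ext x y
  simp only [tensorOp, Matrix.mul_apply, Matrix.of_apply, ← Finset.prod_mul_distrib]
  rw [Finset.prod_univ_sum, Fintype.piFinset_univ]

lemma tensorOp_one : tensorOp (fun _ : ι => 1) = 1 := by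
  ext x y
  simp only [tensorOp, Matrix.of_apply, Matrix.one_apply, Finset.prod_ite_zero,
    Finset.mem_univ, true_implies, funext_iff, Finset.prod_const_one]

lemma tensorOp_conjTranspose (M : ι → Matrix (Fin 2) (Fin 2) ℂ) :
    (tensorOp M)ᴴ = tensorOp fun j => (M j)ᴴ := by
  ext x y
  simp [tensorOp, Matrix.conjTranspose_apply]

lemma tensorOp_mulVec [DecidableEq ι] (M : ι → Matrix (Fin 2) (Fin 2) ℂ) (w : ι → Fin 2 → ℂ) :
    tensorOp M *ᵥ tensorVec w = tensorVec fun j => M j *ᵥ w j := by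
  ext x
  simp only [tensorOp, tensorVec, Matrix.mulVec, dotProduct, Matrix.of_apply,
    ← Finset.prod_mul_distrib]
  rw [Finset.prod_univ_sum, Fintype.piFinset_univ]

lemma tensorVec_dotProduct_star [DecidableEq ι] (w w' : ι → Fin 2 → ℂ) :
    tensorVec w ⬝ᵥ star (tensorVec w') = ∏ j, w j ⬝ᵥ star (w' j) := by
  simp only [tensorVec, dotProduct, Pi.star_apply, star_prod, ← Finset.prod_mul_distrib]
  rw [Finset.prod_univ_sum, Fintype.piFinset_univ]

lemma tensorVec_ite_smul [DecidableEq ι] (i : ι) (c : ℂ) (w : ι → Fin 2 → ℂ) :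
    tensorVec (fun j => if j = i then c • w j else w j) = c • tensorVec w := by
  ext x
  have : ∀ j, (if j = i then c • w j else w j) (x j) = (if j = i then c else 1) * w j (x j) := by
    intro j
    split_ifs <;> simp
  simp only [tensorVec, Pi.smul_apply, smul_eq_mul]
  rw [Finset.prod_congr rfl fun j _ => this j, Finset.prod_mul_distrib]
  simp

end Tensor

/-! ### Single-site operators and the spin along n -/

section Site

variable {N : ℕ}

lemma siteOp_eq_tensorOp (i : Fin N) (K : Matrix (Fin 2) (Fin 2) ℂ) :
    siteOp i K = tensorOp fun j => if j = i then K else 1 := rfl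

lemma siteOp_apply (i : Fin N) (K : Matrix (Fin 2) (Fin 2) ℂ) (x y : Fin N → Fin 2) :
    siteOp i K x y =
      K (x i) (y i) * ∏ j ∈ Finset.univ.erase i, (1 : Matrix (Fin 2) (Fin 2) ℂ) (x j) (y j) := by
  rw [siteOp, Matrix.of_apply, ← Finset.mul_prod_erase _ _ (Finset.mem_univ i), if_pos rfl]
  congr 1
  refine Finset.prod_congr rfl fun j hj => ?_
  rw [if_neg (Finset.ne_of_mem_erase hj)]

lemma siteOp_smul (i : Fin N) (c : ℂ) (K : Matrix (Fin 2) (Fin 2) ℂ) :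
    siteOp i (c • K) = c • siteOp i K := by
  ext x y
  simp [siteOp_apply, mul_assoc]

lemma siteOp_sum {α : Type*} (s : Finset α) (i : Fin N) (K : α → Matrix (Fin 2) (Fin 2) ℂ) :
    siteOp i (∑ a ∈ s, K a) = ∑ a ∈ s, siteOp i (K a) := by
  ext x y
  simp [siteOp_apply, Matrix.sum_apply, Finset.sum_mul]

lemma siteOp_one (i : Fin N) : siteOp i 1 = 1 := by
  rw [siteOp_eq_tensorOp, ← tensorOp_one]
  simp

lemma siteOp_mul (i : Fin N) (K K' : Matrix (Fin 2) (Fin 2) ℂ) :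
    siteOp i K * siteOp i K' = siteOp i (K * K') := by
  simp only [siteOp_eq_tensorOp, tensorOp_mul]
  congr 1
  ext j : 1
  split_ifs <;> simp

lemma siteOp_isHermitian (i : Fin N) {K : Matrix (Fin 2) (Fin 2) ℂ} (hK : K.IsHermitian) :
    (siteOp i K).IsHermitian := by
  rw [Matrix.IsHermitian, siteOp_eq_tensorOp, tensorOp_conjTranspose]
  congr 1
  ext j : 1
  split_ifs
  · exact hK
  · simp

/-- The spin `n·σ / 2` of a single qubit in the direction `n`. -/
def spinDir (n : EuclideanSpace ℝ (Fin 3)) : Matrix (Fin 2) (Fin 2) ℂ :=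
  ∑ a : Fin 3, ((n a / 2 : ℝ) : ℂ) • pauli a

lemma collectiveSpin_eq_sum (N : ℕ) (n : EuclideanSpace ℝ (Fin 3)) :
    collectiveSpin N n = ∑ i : Fin N, siteOp i (spinDir n) := by
  simp only [collectiveSpin, spinDir, siteOp_sum, siteOp_smul]

lemma spinDir_eq (n : EuclideanSpace ℝ (Fin 3)) :
    spinDir n = !![(n 2 / 2 : ℂ), n 0 / 2 - n 1 / 2 * Complex.I;
      n 0 / 2 + n 1 / 2 * Complex.I, -(n 2 / 2 : ℂ)] := by
  ext i j
  fin_cases i <;> fin_cases j <;> (simp [spinDir, pauli, Fin.sum_univ_three]; try ring)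

lemma spinDir_isHermitian (n : EuclideanSpace ℝ (Fin 3)) : (spinDir n).IsHermitian := by
  rw [spinDir_eq]
  refine Matrix.IsHermitian.ext fun i j => ?_
  fin_cases i <;> fin_cases j <;> (simp; try ring)

lemma spinDir_trace (n : EuclideanSpace ℝ (Fin 3)) : (spinDir n).trace = 0 := by
  simp [spinDir_eq, Matrix.trace, Fin.sum_univ_two]

/-- The Pauli matrices anticommute and square to 1. This is where the unit length of `n` enters. -/
lemma spinDir_mul_self {n : EuclideanSpace ℝ (Fin 3)} (hn : ‖n‖ = 1) :
    spinDir n * spinDir n = ((1 / 4 : ℝ) : ℂ) • 1 := by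
  have h : (n 0 : ℂ) ^ 2 + (n 1 : ℂ) ^ 2 + (n 2 : ℂ) ^ 2 = 1 := by
    have := EuclideanSpace.real_norm_sq_eq n
    rw [hn, Fin.sum_univ_three] at this
    norm_cast
    linarith
  rw [spinDir_eq]
  ext i j
  fin_cases i <;> fin_cases j <;> simp [Matrix.mul_apply, Fin.sum_univ_two]
  · linear_combination h / 4 - (n 1 : ℂ) ^ 2 / 4 * Complex.I_sq
  · ring
  · ring
  · linear_combination h / 4 - (n 1 : ℂ) ^ 2 / 4 * Complex.I_sq

lemma collectiveSpin_isHermitian (N : ℕ) (n : EuclideanSpace ℝ (Fin 3)) :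
    (collectiveSpin N n).IsHermitian := by
  rw [collectiveSpin_eq_sum, Matrix.IsHermitian, Matrix.conjTranspose_sum]
  exact Finset.sum_congr rfl fun i _ => siteOp_isHermitian i (spinDir_isHermitian n)

lemma siteOp_spinDir_mul_self {n : EuclideanSpace ℝ (Fin 3)} (hn : ‖n‖ = 1) (i : Fin N) :
    siteOp i (spinDir n) * siteOp i (spinDir n) = ((1 / 4 : ℝ) : ℂ) • 1 := by
  rw [siteOp_mul, spinDir_mul_self hn, siteOp_smul, siteOp_one]

end Site

/-! ### Algebra and traces of block product operators -/

section Partition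

variable {N : ℕ} (Λ : QubitPartition N)

/-- A configuration of all qubits amounts to a configuration of every subset of a partition. -/
def configEquiv : (Fin N → Fin 2) ≃ ((A : Λ.parts) → A.1 → Fin 2) where
  toFun x _ i := x i
  invFun p i := p ⟨Λ.part i, Λ.part_mem.2 (Finset.mem_univ i)⟩
    ⟨i, Λ.mem_part_self.2 (Finset.mem_univ i)⟩
  left_inv _ := rfl
  right_inv p := by
    ext ⟨A, hA⟩ ⟨i, hi⟩ : 2
    obtain rfl := Λ.part_eq_of_mem hA hi
    rfl

/-- Distributivity, since a configuration is an independent choice on each block; multiplicativity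
and the trace formula for `partitionTensor` both follow from it. -/
lemma sum_prod_parts (f : (A : Finset (Fin N)) → (A → Fin 2) → ℂ) :
    ∑ x : Fin N → Fin 2, ∏ A ∈ Λ.parts, f A (fun i => x i) = ∏ A ∈ Λ.parts, ∑ y, f A y := by
  rw [← Finset.prod_coe_sort Λ.parts fun A => ∑ y, f A y, Finset.prod_univ_sum,
    Fintype.piFinset_univ]
  refine Fintype.sum_equiv (configEquiv Λ) _ _ fun x => ?_
  rw [← Finset.prod_coe_sort]
  rfl

lemma prod_parts_prod (f : Fin N → ℂ) : ∏ A ∈ Λ.parts, ∏ i : A, f i = ∏ i, f i := by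
  conv_rhs => rw [← Λ.biUnion_parts, Finset.prod_biUnion Λ.disjoint]
  exact Finset.prod_congr rfl fun A _ => Finset.prod_coe_sort A f

variable (σ τ : (A : Finset (Fin N)) → QubitOp A)

lemma partitionTensor_mul :
    partitionTensor Λ σ * partitionTensor Λ τ = partitionTensor Λ fun A => σ A * τ A := by
  ext x y
  simp only [partitionTensor, Matrix.mul_apply, Matrix.of_apply, ← Finset.prod_mul_distrib]
  exact sum_prod_parts Λ fun A z => σ A (fun i => x i) z * τ A z (fun i => y i)

lemma trace_partitionTensor :
    (partitionTensor Λ σ).trace = ∏ A ∈ Λ.parts, (σ A).trace :=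
  sum_prod_parts Λ fun A z => σ A z z

lemma partitionTensor_conjTranspose :
    (partitionTensor Λ σ)ᴴ = partitionTensor Λ fun A => (σ A)ᴴ := by
  ext x y
  simp [partitionTensor, Matrix.conjTranspose_apply]

lemma partitionTensor_congr {σ τ : (A : Finset (Fin N)) → QubitOp A}
    (h : ∀ A ∈ Λ.parts, σ A = τ A) : partitionTensor Λ σ = partitionTensor Λ τ := by
  ext x y
  exact Finset.prod_congr rfl fun A hA => by rw [h A hA]

lemma partitionTensor_tensorOp (M : Fin N → Matrix (Fin 2) (Fin 2) ℂ) :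
    partitionTensor Λ (fun A => tensorOp fun j : A => M j) = tensorOp M := by
  ext x y
  exact prod_parts_prod Λ fun i => M i (x i) (y i)

open scoped MatrixOrder Matrix.Norms.L2Operator in
lemma exists_eq_conjTranspose_mul_self {κ : Type} [Fintype κ] [DecidableEq κ] {ρ : Matrix κ κ ℂ}
    (h : ρ.PosSemidef) : ∃ B : Matrix κ κ ℂ, ρ = Bᴴ * B :=
  CStarAlgebra.nonneg_iff_eq_star_mul_self.1 h.nonneg

/-- Factoring each block as BᴴB exhibits the tensor product in the same form. -/
lemma partitionTensor_posSemidef {σ : (A : Finset (Fin N)) → QubitOp A}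
    (h : ∀ A ∈ Λ.parts, (σ A).PosSemidef) : (partitionTensor Λ σ).PosSemidef := by
  classical
  have h' : ∀ A : Finset (Fin N), ∃ B : QubitOp A, A ∈ Λ.parts → σ A = Bᴴ * B := by
    intro A
    by_cases hA : A ∈ Λ.parts
    · obtain ⟨B, hB⟩ := exists_eq_conjTranspose_mul_self (h A hA)
      exact ⟨B, fun _ => hB⟩
    · exact ⟨0, fun h => absurd h hA⟩
  choose B hB using h'
  rw [partitionTensor_congr Λ hB, ← partitionTensor_mul Λ (fun A => (B A)ᴴ) B,
    ← partitionTensor_conjTranspose]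
  exact Matrix.posSemidef_conjTranspose_mul_self _

/-- The operator `K` on the qubit `i`, restricted to the qubits in `A`; the identity if `i` is not
in `A`. -/
def localSiteOp (A : Finset (Fin N)) (i : Fin N) (K : Matrix (Fin 2) (Fin 2) ℂ) : QubitOp A :=
  tensorOp fun j : A => if (j : Fin N) = i then K else 1

lemma siteOp_eq_partitionTensor (i : Fin N) (K : Matrix (Fin 2) (Fin 2) ℂ) :
    siteOp i K = partitionTensor Λ fun A => localSiteOp A i K :=
  (partitionTensor_tensorOp Λ _).symm

lemma localSiteOp_of_notMem {A : Finset (Fin N)} {i : Fin N} (h : i ∉ A)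
    (K : Matrix (Fin 2) (Fin 2) ℂ) : localSiteOp A i K = 1 := by
  rw [localSiteOp, ← tensorOp_one]
  congr 1
  ext j : 1
  rw [if_neg]
  rintro rfl
  exact h j.2

variable {σ} (hσ : ∀ A ∈ Λ.parts, (σ A).trace = 1)
include hσ

lemma trace_partitionTensor_mul_siteOp (i : Fin N) (K : Matrix (Fin 2) (Fin 2) ℂ) :
    (partitionTensor Λ σ * siteOp i K).trace =
      (σ (Λ.part i) * localSiteOp (Λ.part i) i K).trace := by
  rw [siteOp_eq_partitionTensor Λ, partitionTensor_mul, trace_partitionTensor]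
  refine Finset.prod_eq_single_of_mem _ (Λ.part_mem.2 (Finset.mem_univ i)) fun A hA hne => ?_
  rw [localSiteOp_of_notMem, Matrix.mul_one, hσ A hA]
  exact fun h => hne (Λ.part_eq_of_mem hA h).symm

lemma trace_partitionTensor_mul_siteOp_siteOp_same {i j : Fin N} (hij : Λ.part i = Λ.part j)
    (K : Matrix (Fin 2) (Fin 2) ℂ) :
    (partitionTensor Λ σ * (siteOp i K * siteOp j K)).trace =
      (σ (Λ.part i) * (localSiteOp (Λ.part i) i K * localSiteOp (Λ.part i) j K)).trace := by
  rw [siteOp_eq_partitionTensor Λ, siteOp_eq_partitionTensor Λ, partitionTensor_mul,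
    partitionTensor_mul, trace_partitionTensor]
  refine Finset.prod_eq_single_of_mem _ (Λ.part_mem.2 (Finset.mem_univ i)) fun A hA hne => ?_
  rw [localSiteOp_of_notMem, localSiteOp_of_notMem, Matrix.mul_one, Matrix.mul_one, hσ A hA]
  · exact fun h => hne (hij.trans (Λ.part_eq_of_mem hA h)).symm
  · exact fun h => hne (Λ.part_eq_of_mem hA h).symm

/-- Each operator touches only its own block and the remaining blocks have trace 1, so exactly two
factors of the product survive. -/
lemma trace_partitionTensor_mul_siteOp_siteOp_ne {i j : Fin N} (hij : Λ.part i ≠ Λ.part j)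
    (K : Matrix (Fin 2) (Fin 2) ℂ) :
    (partitionTensor Λ σ * (siteOp i K * siteOp j K)).trace =
      (partitionTensor Λ σ * siteOp i K).trace * (partitionTensor Λ σ * siteOp j K).trace := by
  rw [trace_partitionTensor_mul_siteOp Λ hσ, trace_partitionTensor_mul_siteOp Λ hσ,
    siteOp_eq_partitionTensor Λ, siteOp_eq_partitionTensor Λ, partitionTensor_mul,
    partitionTensor_mul, trace_partitionTensor]
  have hi := Λ.part_mem.2 (Finset.mem_univ i)
  have hj := Λ.part_mem.2 (Finset.mem_univ j)
  rw [Finset.prod_eq_mul_of_mem _ _ hi hj hij]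
  · rw [localSiteOp_of_notMem (A := Λ.part i) (i := j), Matrix.mul_one,
      localSiteOp_of_notMem (A := Λ.part j) (i := i), Matrix.one_mul]
    · exact fun h => hij (Λ.part_eq_of_mem hj h)
    · exact fun h => hij (Λ.part_eq_of_mem hi h).symm
  · rintro A hA ⟨hAi, hAj⟩
    rw [localSiteOp_of_notMem, localSiteOp_of_notMem, Matrix.mul_one, Matrix.mul_one, hσ A hA]
    · exact fun h => hAj (Λ.part_eq_of_mem hA h).symm
    · exact fun h => hAi (Λ.part_eq_of_mem hA h).symm

end Partition

/-! ### Sums of squares of block sizes at bounded Dyson's rank -/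

section Combinatorics

variable {N : ℕ}

lemma sum_card_part (Λ : QubitPartition N) :
    ∑ i, (Λ.part i).card = ∑ A ∈ Λ.parts, A.card ^ 2 := by
  have h := Finset.sum_biUnion Λ.disjoint (f := fun i => (Λ.part i).card)
  rw [Λ.biUnion_parts] at h
  rw [h]
  refine Finset.sum_congr rfl fun A hA => ?_
  rw [id, Finset.sum_congr rfl fun i hi => by rw [Λ.part_eq_of_mem hA hi], Finset.sum_const,
    smul_eq_mul, sq]

lemma rankPartitions_nonempty {r : ℤ} (hr : -((N : ℤ) - 1) ≤ r) :
    (rankPartitions N r).Nonempty := by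
  -- The partition into singletons has rank 1 - N when N ≥ 1.
  refine ⟨⊥, Finset.mem_filter.2 ⟨Finset.mem_univ _, ?_⟩⟩
  have hw : partitionWidth (⊥ : QubitPartition N) ≤ 1 := by
    refine Finset.sup_le fun A hA => ?_
    obtain ⟨a, -, rfl⟩ := Finpartition.mem_bot_iff.1 hA
    simp
  have hh : partitionHeight (⊥ : QubitPartition N) = N := by
    simp [partitionHeight]
  unfold dysonRank
  rw [hh]
  omega

/-- The excesses `a = N_l - 1` of the sizes: the sum of their squares is controlled by the largest
one, `u`, and their sum. -/
lemma sum_sq_le_of_max {α : Type*} [DecidableEq α] {s : Finset α} {f : α → ℤ} {b : α} (hb : b ∈ s)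
    (h0 : ∀ a ∈ s, 0 ≤ f a) (hmax : ∀ a ∈ s, f a ≤ f b) :
    (f b = 0 → ∑ a ∈ s, f a = 0) ∧ 0 ≤ ∑ a ∈ s, f a - f b ∧
    ∑ a ∈ s, f a ^ 2 ≤ f b ^ 2 + (∑ a ∈ s, f a - f b) * f b ∧
    ∑ a ∈ s, f a ^ 2 ≤ f b ^ 2 + (∑ a ∈ s, f a - f b) ^ 2 := by
  refine ⟨fun h => Finset.sum_eq_zero fun a ha => le_antisymm (h ▸ hmax a ha) (h0 a ha), ?_⟩
  rw [← Finset.add_sum_erase _ _ hb, ← Finset.add_sum_erase _ _ hb, add_sub_cancel_left]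
  have h0' : ∀ a ∈ s.erase b, 0 ≤ f a := fun a ha => h0 a (Finset.mem_of_mem_erase ha)
  refine ⟨Finset.sum_nonneg h0', ?_, ?_⟩
  · gcongr
    rw [Finset.sum_mul]
    refine Finset.sum_le_sum fun a ha => ?_
    rw [sq]
    exact mul_le_mul_of_nonneg_left (hmax a (Finset.mem_of_mem_erase ha)) (h0' a ha)
  · gcongr
    rw [sq, Finset.sum_mul]
    refine Finset.sum_le_sum fun a ha => ?_
    rw [sq]
    exact mul_le_mul_of_nonneg_left (Finset.single_le_sum h0' ha) (h0' a ha)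

/-- Here `u` is the largest excess, `v` the sum of the excesses, `q` the sum of their squares, and
`s` = N + r. By `h1`, 4(q + v) ≤ 4(u + 1)v = (u + v + 1)² - (v - u - 1)², which suffices unless v =
u + 1. In that case `h2` gives q ≤ u² + 1, and only u = 1, s = 4 escapes the first bound. -/
lemma sum_card_sq_le_aux {u v q s : ℤ} (hu : 0 ≤ u) (hu0 : u = 0 → v = 0) (huv : 0 ≤ v - u) (hs : u + v + 1 ≤ s)
    (h1 : q ≤ u ^ 2 + (v - u) * u) (h2 : q ≤ u ^ 2 + (v - u) ^ 2) :
    (s ≠ 4 → 4 * (q + v) ≤ s ^ 2 - 1) ∧ (s = 4 → q + v ≤ 4) := by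
  rcases eq_or_ne v (u + 1) with rfl | hv
  · have h2' : q ≤ u ^ 2 + 1 := by linarith
    have h1' : q ≤ u ^ 2 + u := by linarith
    constructor
    · intro h4
      rcases le_or_gt u 1 with hu1 | hu1
      · obtain rfl | rfl : u = 0 ∨ u = 1 := by omega
        -- If the largest excess is 0, all are, contradicting v = 1.
        · exact absurd (hu0 rfl) (by norm_num)
        · have : 5 ≤ s := by omega
          nlinarith
      · nlinarith
    · rintro rfl
      have : u ≤ 1 := by omega
      nlinarith
  · have h3 : 1 ≤ (v - (u + 1)) ^ 2 := by
      have : v - (u + 1) ≠ 0 := sub_ne_zero.2 hv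
      have : 0 < (v - (u + 1)) ^ 2 := by positivity
      omega
    have h4 : (u + v + 1) ^ 2 ≤ s ^ 2 := pow_le_pow_left₀ (by omega) hs 2
    have h5 : 4 * (q + v) ≤ s ^ 2 - 1 := by nlinarith
    refine ⟨fun _ => h5, ?_⟩
    rintro rfl
    omega

lemma sum_card_sq_le (hN : 1 ≤ N) {r : ℤ} {Λ : QubitPartition N} (hΛ : dysonRank Λ ≤ r) :
    (r ≠ 4 - (N : ℤ) →
      4 * (∑ A ∈ Λ.parts, (A.card : ℤ) ^ 2 - N) ≤ ((N : ℤ) + r) ^ 2 - 1) ∧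
    (r = 4 - (N : ℤ) → ∑ A ∈ Λ.parts, (A.card : ℤ) ^ 2 - N ≤ 4) := by
  have hne : Λ.parts.Nonempty :=
    Λ.parts_nonempty (Finset.nonempty_iff_ne_empty.1 ⟨⟨0, hN⟩, Finset.mem_univ _⟩)
  obtain ⟨B, hB, hBw⟩ := Finset.exists_mem_eq_sup Λ.parts hne Finset.card
  have hpos : ∀ A ∈ Λ.parts, 0 ≤ (A.card : ℤ) - 1 := fun A hA => by
    have := (Λ.nonempty_of_mem_parts hA).card_pos
    omega
  have hmax : ∀ A ∈ Λ.parts, (A.card : ℤ) - 1 ≤ (B.card : ℤ) - 1 := fun A hA => by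
    have : A.card ≤ B.card := hBw ▸ Finset.le_sup hA
    omega
  obtain ⟨hu, h0, h1, h2⟩ := sum_sq_le_of_max hB hpos hmax
  have hsum : ∑ A ∈ Λ.parts, ((A.card : ℤ) - 1) = N - partitionHeight Λ := by
    have := Λ.sum_card_parts
    rw [Finset.card_univ, Fintype.card_fin] at this
    rw [Finset.sum_sub_distrib, ← Nat.cast_sum, this]
    simp [partitionHeight]
  have hsq : ∑ A ∈ Λ.parts, (A.card : ℤ) ^ 2 - N =
      ∑ A ∈ Λ.parts, ((A.card : ℤ) - 1) ^ 2 + ∑ A ∈ Λ.parts, ((A.card : ℤ) - 1) := by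
    have h : ∀ A : Finset (Fin N), (A.card : ℤ) ^ 2 =
        ((A.card : ℤ) - 1) ^ 2 + 2 * ((A.card : ℤ) - 1) + 1 := fun A => by ring
    rw [Finset.sum_congr rfl fun A _ => h A, Finset.sum_add_distrib, Finset.sum_add_distrib,
      ← Finset.mul_sum, hsum]
    simp only [Finset.sum_const, partitionHeight]
    simp
    ring
  -- With width w and height h, the left side is (w - 1) + (N - h) + 1 = N + (w - h).
  have hs : ((B.card : ℤ) - 1) + ∑ A ∈ Λ.parts, ((A.card : ℤ) - 1) + 1 ≤ (N : ℤ) + r := by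
    rw [hsum]
    unfold dysonRank partitionWidth at hΛ
    rw [hBw] at hΛ
    omega
  have := sum_card_sq_le_aux (hpos B hB) hu h0 hs h1 h2
  rw [hsq]
  refine ⟨fun hr => this.1 (by omega), fun hr => this.2 (by omega)⟩

lemma rankBound_le (hN : 1 ≤ N) {r : ℤ} (hr : -((N : ℤ) - 1) ≤ r) :
    (r ≠ 4 - (N : ℤ) → (rankBound N r : ℝ) ≤ ((N : ℝ) + (r : ℝ)) ^ 2 / 4 - 1 / 4 + (N : ℝ)) ∧
    (r = 4 - (N : ℤ) → (rankBound N r : ℝ) ≤ (N : ℝ) + 4) := by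
  obtain ⟨Λ, hΛ, h⟩ := Finset.exists_mem_eq_sup (rankPartitions N r)
    (rankPartitions_nonempty hr) fun Λ => ∑ A ∈ Λ.parts, A.card ^ 2
  have hb := sum_card_sq_le hN (Finset.mem_filter.1 hΛ).2
  rw [rankBound, h]
  refine ⟨fun hr => ?_, fun hr => ?_⟩
  · have := hb.1 hr
    have : (4 * (∑ A ∈ Λ.parts, (A.card : ℝ) ^ 2 - N)) ≤ ((N : ℝ) + r) ^ 2 - 1 := by
      exact_mod_cast this
    push_cast
    linarith
  · have := hb.2 hr
    have : ∑ A ∈ Λ.parts, (A.card : ℝ) ^ 2 - N ≤ 4 := by exact_mod_cast this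
    push_cast
    linarith

end Combinatorics

/-! ### Upper bound through covariances -/

section UpperBound

lemma trace_mul_eq_expval {κ : Type} [Fintype κ] {ρ M : Matrix κ κ ℂ} (hρ : ρ.IsHermitian)
    (hM : M.IsHermitian) : (ρ * M).trace = (expval ρ M : ℂ) := by
  refine (Complex.conj_eq_iff_re.1 ?_).symm
  rw [← RCLike.star_def, ← Matrix.trace_conjTranspose, Matrix.conjTranspose_mul, hρ.eq, hM.eq,
    Matrix.trace_mul_comm]

lemma expval_one {κ : Type} [Fintype κ] [DecidableEq κ] {ρ : Matrix κ κ ℂ} (h : ρ.trace = 1) :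
    expval ρ 1 = 1 := by
  simp [expval, h]

lemma expval_centered_mul {κ : Type} [Fintype κ] [DecidableEq κ] {ρ : Matrix κ κ ℂ}
    (h : ρ.trace = 1) (A B : Matrix κ κ ℂ) :
    expval ρ ((A - (expval ρ A : ℂ) • 1) * (B - (expval ρ B : ℂ) • 1)) =
      expval ρ (A * B) - expval ρ A * expval ρ B := by
  simp only [Matrix.sub_mul, Matrix.mul_sub, smul_mul_assoc, mul_smul_comm, Matrix.one_mul,
    Matrix.mul_one, expval_sub, expval_real_smul, expval_one h]
  ring

/-- Covariances are bounded by the mean of the variances. -/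
lemma expval_add_expval_mul_comm_le {κ : Type} [Fintype κ] [DecidableEq κ] {ρ A B : Matrix κ κ ℂ}
    (hρ : ρ.PosSemidef) (hA : A.IsHermitian) (hB : B.IsHermitian) :
    expval ρ (A * B) + expval ρ (B * A) ≤ expval ρ (A * A) + expval ρ (B * B) := by
  have h := expval_star_mul_self_nonneg hρ (A - B)
  rw [Matrix.conjTranspose_sub, hA.eq, hB.eq] at h
  simp only [Matrix.sub_mul, Matrix.mul_sub, expval_sub] at h
  linarith

lemma expval_mul_comm {κ : Type} [Fintype κ] {ρ A B : Matrix κ κ ℂ}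
    (hρ : ρ.IsHermitian) (hA : A.IsHermitian) (hB : B.IsHermitian) :
    expval ρ (A * B) = expval ρ (B * A) := by
  have : star (ρ * (A * B)).trace = (ρ * (B * A)).trace := by
    rw [← Matrix.trace_conjTranspose, Matrix.conjTranspose_mul, Matrix.conjTranspose_mul, hρ.eq,
      hA.eq, hB.eq, Matrix.trace_mul_comm]
  rw [expval, expval, ← this, RCLike.star_def, Complex.conj_re]

variable {N : ℕ} {Λ : QubitPartition N} {σ : (A : Finset (Fin N)) → QubitOp A}

lemma partitionTensor_isDensityMatrix (hσ : ∀ A ∈ Λ.parts, IsDensityMatrix (σ A)) :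
    IsDensityMatrix (partitionTensor Λ σ) :=
  ⟨partitionTensor_posSemidef Λ fun A hA => (hσ A hA).1, by
    rw [trace_partitionTensor]
    exact Finset.prod_eq_one fun A hA => (hσ A hA).2⟩

lemma isHermitian_sub_real_smul_one {κ : Type} [Fintype κ] [DecidableEq κ] {A : Matrix κ κ ℂ}
    (hA : A.IsHermitian) (c : ℝ) : (A - (c : ℂ) • (1 : Matrix κ κ ℂ)).IsHermitian := by
  rw [Matrix.IsHermitian, Matrix.conjTranspose_sub, hA.eq, Matrix.conjTranspose_smul]
  simp

/-- Within a block, the covariance is at most the mean of the two variances, each at most 1/4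
because the squared spin is 1/4. Across blocks, expectations factorize. -/
lemma covariance_le {n : EuclideanSpace ℝ (Fin 3)} (hn : ‖n‖ = 1)
    (hσ : ∀ A ∈ Λ.parts, IsDensityMatrix (σ A)) (i j : Fin N) :
    expval (partitionTensor Λ σ) (siteOp i (spinDir n) * siteOp j (spinDir n)) -
        expval (partitionTensor Λ σ) (siteOp i (spinDir n)) *
          expval (partitionTensor Λ σ) (siteOp j (spinDir n)) ≤
      if Λ.part i = Λ.part j then 1 / 4 else 0 := by
  have hρ := partitionTensor_isDensityMatrix hσ
  have hS : ∀ i : Fin N, (siteOp i (spinDir n)).IsHermitian :=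
    fun i => siteOp_isHermitian i (spinDir_isHermitian n)
  split_ifs with h
  · have hvar : ∀ i : Fin N, expval (partitionTensor Λ σ)
        (siteOp i (spinDir n) * siteOp i (spinDir n)) -
        expval (partitionTensor Λ σ) (siteOp i (spinDir n)) *
          expval (partitionTensor Λ σ) (siteOp i (spinDir n)) ≤ 1 / 4 := fun i => by
      rw [siteOp_spinDir_mul_self hn, expval_real_smul, expval_one hρ.2]
      nlinarith [mul_self_nonneg (expval (partitionTensor Λ σ) (siteOp i (spinDir n)))]
    have hc := expval_add_expval_mul_comm_le hρ.1
      (isHermitian_sub_real_smul_one (hS i) (expval (partitionTensor Λ σ) (siteOp i (spinDir n))))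
      (isHermitian_sub_real_smul_one (hS j) (expval (partitionTensor Λ σ) (siteOp j (spinDir n))))
    simp only [expval_centered_mul hρ.2] at hc
    rw [expval_mul_comm hρ.1.1 (hS j) (hS i)] at hc
    have := hvar i
    have := hvar j
    linarith
  · have ht := trace_partitionTensor_mul_siteOp_siteOp_ne Λ (fun A hA => (hσ A hA).2) h (spinDir n)
    rw [trace_mul_eq_expval hρ.1.1 (hS i), trace_mul_eq_expval hρ.1.1 (hS j),
      ← Complex.ofReal_mul] at ht
    rw [expval, ht, Complex.ofReal_re, sub_self]

lemma sum_ite_part_eq (Λ : QubitPartition N) :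
    ∑ i, ∑ j, (if Λ.part i = Λ.part j then 1 / 4 else 0 : ℝ) =
      (∑ A ∈ Λ.parts, A.card ^ 2 : ℕ) / 4 := by
  rw [← sum_card_part, Nat.cast_sum, Finset.sum_div]
  refine Finset.sum_congr rfl fun i _ => ?_
  have : Finset.univ.filter (fun j => Λ.part i = Λ.part j) = Λ.part i := by
    ext j
    rw [Finset.mem_filter, Λ.mem_part_iff_part_eq_part (Finset.mem_univ j) (Finset.mem_univ i)]
    simp [eq_comm]
  rw [← Finset.sum_filter, this, Finset.sum_const, nsmul_eq_mul]
  ring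

lemma sldForm_partitionTensor_le {n : EuclideanSpace ℝ (Fin 3)} (hn : ‖n‖ = 1)
    (hσ : ∀ A ∈ Λ.parts, IsDensityMatrix (σ A)) {X : QubitOp (Fin N)} (hX : X.IsHermitian) :
    sldForm (partitionTensor Λ σ) (collectiveSpin N n) X ≤ (∑ A ∈ Λ.parts, A.card ^ 2 : ℕ) := by
  have hρ := partitionTensor_isDensityMatrix hσ
  set ρ := partitionTensor Λ σ with hρd
  -- Shifting by the mean turns the second moment into the variance.
  have h := sldForm_le_expval_sq hρ.1 (collectiveSpin_isHermitian N n) hX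
    (expval ρ (collectiveSpin N n))
  rw [expval_centered_mul hρ.2, collectiveSpin_eq_sum, Finset.sum_mul_sum] at h
  simp only [expval_sum] at h
  rw [Finset.sum_mul_sum, ← Finset.sum_sub_distrib] at h
  simp only [← Finset.sum_sub_distrib] at h
  have h2 := sum_ite_part_eq Λ
  have h3 := Finset.sum_le_sum fun i (_ : i ∈ Finset.univ) =>
    Finset.sum_le_sum fun j (_ : j ∈ Finset.univ) => covariance_le hn hσ i j
  rw [h2] at h3
  rw [collectiveSpin_eq_sum]
  linarith

lemma IsPartitionSeparable.posSemidef {ρ : QubitOp (Fin N)} (h : IsPartitionSeparable Λ ρ) :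
    ρ.PosSemidef := by
  obtain ⟨m, p, σ, hp, -, hσ, rfl⟩ := h
  refine Matrix.posSemidef_sum _ fun γ _ => ?_
  exact (partitionTensor_isDensityMatrix (hσ γ)).1.smul (Complex.zero_le_real.2 (hp γ))

lemma IsPartitionSeparable.sldForm_le {ρ : QubitOp (Fin N)} (h : IsPartitionSeparable Λ ρ)
    {n : EuclideanSpace ℝ (Fin 3)} (hn : ‖n‖ = 1) {X : QubitOp (Fin N)} (hX : X.IsHermitian) :
    sldForm ρ (collectiveSpin N n) X ≤ (∑ A ∈ Λ.parts, A.card ^ 2 : ℕ) := by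
  obtain ⟨m, p, σ, hp, hp1, hσ, rfl⟩ := h
  rw [sldForm, expval_sum_smul_state]
  calc _ ≤ ∑ γ, p γ * ((∑ A ∈ Λ.parts, A.card ^ 2 : ℕ) : ℝ) :=
        Finset.sum_le_sum fun γ _ => mul_le_mul_of_nonneg_left
          (sldForm_partitionTensor_le hn (hσ γ) hX) (hp γ)
    _ = _ := by rw [← Finset.sum_mul, hp1, one_mul]

lemma HasDysonRankLE.posSemidef {r : ℤ} {ρ : QubitOp (Fin N)} (h : HasDysonRankLE r ρ) :
    ρ.PosSemidef := by
  obtain ⟨P, τ, hP, -, hτ, rfl⟩ := h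
  exact Matrix.posSemidef_sum _ fun Λ hΛ =>
    (hτ Λ hΛ).posSemidef.smul (Complex.zero_le_real.2 (hP Λ hΛ))

/-- The quantum Fisher information of a state with bounded Dyson's rank. -/
lemma HasDysonRankLE.qfi_le {r : ℤ} {ρ : QubitOp (Fin N)} (h : HasDysonRankLE r ρ)
    {n : EuclideanSpace ℝ (Fin 3)} (hn : ‖n‖ = 1) :
    qfi ρ (collectiveSpin N n) ≤ rankBound N r := by
  -- `X` is optimal for the whole mixture and is kept fixed while the functional is expanded
  -- linearly over its components.
  obtain ⟨X, hX, hXq⟩ := exists_sldForm_eq_qfi h.posSemidef (collectiveSpin_isHermitian N n)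
  obtain ⟨P, τ, hP, hP1, hτ, rfl⟩ := h
  rw [← hXq, sldForm, expval_sum_smul_state]
  calc _ ≤ ∑ Λ ∈ rankPartitions N r, P Λ * (rankBound N r : ℝ) :=
        Finset.sum_le_sum fun Λ hΛ => mul_le_mul_of_nonneg_left
          (((hτ Λ hΛ).sldForm_le hn hX).trans (Nat.cast_le.2
            (Finset.le_sup (f := fun Λ : QubitPartition N => ∑ A ∈ Λ.parts, A.card ^ 2) hΛ)))
          (hP Λ hΛ)
    _ = _ := by rw [← Finset.sum_mul, hP1, one_mul]

end UpperBound

/-! ### Attainment by products of GHZ states -/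

section Attainment

/-- A pure state with vanishing mean of `H` has quantum Fisher information at least `4⟨H²⟩`. -/
lemma four_mul_expval_sq_le_qfi {κ : Type} [Fintype κ] {ρ H : Matrix κ κ ℂ} (hρ : ρ.PosSemidef)
    (hρρ : ρ * ρ = ρ) (hH : H.IsHermitian) (h0 : ρ * H * ρ = 0) :
    4 * expval ρ (H * H) ≤ qfi ρ H := by
  -- This is the optimal `X` for a projection: λ_k + λ_l = 1 whenever λ_k ≠ λ_l.
  have hX : ((2 * Complex.I) • (ρ * H - H * ρ)).IsHermitian := by
    rw [Matrix.IsHermitian, Matrix.conjTranspose_smul, Matrix.conjTranspose_sub,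
      Matrix.conjTranspose_mul, Matrix.conjTranspose_mul, hρ.1.eq, hH.eq]
    simp only [star_mul', RCLike.star_def, Complex.conj_I, map_ofNat, mul_neg, neg_smul, smul_sub]
    abel
  refine le_trans (le_of_eq ?_) (sldForm_le_qfi hρ hH hX)
  have hI : 2 * Complex.I * (2 * Complex.I) = -4 := by linear_combination 4 * Complex.I_mul_I
  have e0 : ∀ M, ρ * (H * (ρ * M)) = 0 := fun M => by
    rw [← Matrix.mul_assoc, ← Matrix.mul_assoc, h0, Matrix.zero_mul]
  have e0' : ρ * (H * ρ) = 0 := by rw [← Matrix.mul_assoc, h0]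
  have e1 : ∀ M, ρ * (ρ * M) = ρ * M := fun M => by rw [← Matrix.mul_assoc, hρρ]
  have ht : (ρ * (H * (H * ρ))).trace = (ρ * (H * H)).trace := by
    rw [← Matrix.mul_assoc H, ← Matrix.mul_assoc, Matrix.trace_mul_comm, e1]
  unfold sldForm expval
  simp only [Matrix.mul_sub, Matrix.sub_mul, smul_mul_assoc, mul_smul_comm, smul_sub, smul_smul,
    Matrix.mul_assoc, hI, e0, e0', e1, Matrix.trace_sub, Matrix.trace_smul, ht]
  simp

lemma exists_spinDir_eigenvectors {n : EuclideanSpace ℝ (Fin 3)} (hn : ‖n‖ = 1) :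
    ∃ (u v : Fin 2 → ℂ) (a : ℝ), a * a = 1 / 4 ∧ u ⬝ᵥ star u = 1 ∧ v ⬝ᵥ star v = 1 ∧
      u ⬝ᵥ star v = 0 ∧ v ⬝ᵥ star u = 0 ∧
      spinDir n *ᵥ u = (a : ℂ) • u ∧ spinDir n *ᵥ v = (-a : ℂ) • v := by
  have hK := spinDir_isHermitian n
  set b := hK.eigenvectorBasis
  have hb : ∀ i j, (b i : Fin 2 → ℂ) ⬝ᵥ star (b j : Fin 2 → ℂ) = if j = i then 1 else 0 := by
    intro i j
    rw [← EuclideanSpace.inner_eq_star_dotProduct]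
    exact orthonormal_iff_ite.1 b.orthonormal j i
  -- The trace vanishes, so the eigenvalues are opposite; squaring the operator then fixes their
  -- modulus at 1/2.
  have hs : hK.eigenvalues 1 = -hK.eigenvalues 0 := by
    have := hK.trace_eq_sum_eigenvalues
    rw [spinDir_trace, Fin.sum_univ_two] at this
    have h : hK.eigenvalues 0 + hK.eigenvalues 1 = 0 := by
      apply Complex.ofReal_injective
      rw [Complex.ofReal_add, Complex.ofReal_zero]
      exact this.symm
    linarith
  have h0 : spinDir n *ᵥ (b 0 : Fin 2 → ℂ) = hK.eigenvalues 0 • (b 0 : Fin 2 → ℂ) :=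
    hK.mulVec_eigenvectorBasis 0
  have h1 := hK.mulVec_eigenvectorBasis 1
  refine ⟨b 0, b 1, hK.eigenvalues 0, ?_, by simp [hb], by simp [hb], by simp [hb], by simp [hb],
    h0, ?_⟩
  · have h : spinDir n *ᵥ (spinDir n *ᵥ (b 0 : Fin 2 → ℂ)) =
        hK.eigenvalues 0 • hK.eigenvalues 0 • (b 0 : Fin 2 → ℂ) := by
      rw [h0, Matrix.mulVec_smul, h0]
    rw [Matrix.mulVec_mulVec, spinDir_mul_self hn, Matrix.smul_mulVec, Matrix.one_mulVec] at h
    have h' := congrArg (fun w => w ⬝ᵥ star (b 0 : Fin 2 → ℂ)) h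
    simp only [smul_dotProduct, hb] at h'
    have := congrArg Complex.re h'
    simp at this
    linarith
  · rw [hs] at h1
    refine h1.trans ?_
    ext i
    simp [b]

variable {ι : Type} [Fintype ι]

/-- The Greenberger-Horne-Zeilinger vector `(u ⊗ ⋯ ⊗ u + v ⊗ ⋯ ⊗ v) / √2`. -/
def ghzVec (ι : Type) [Fintype ι] (u v : Fin 2 → ℂ) : (ι → Fin 2) → ℂ :=
  ((√(1 / 2) : ℝ) : ℂ) • (tensorVec (fun _ => u) + tensorVec (fun _ => v))

lemma sqrt_half_mul_self : ((√(1 / 2) : ℝ) : ℂ) * ((√(1 / 2) : ℝ) : ℂ) = 1 / 2 := by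
  rw [← Complex.ofReal_mul, Real.mul_self_sqrt (by norm_num)]
  push_cast
  rfl

/-- Cross terms are powers of ⟨u, v⟩ with positive exponent, hence 0. General `c` and `d` are needed
because site operators rescale the two branches separately. -/
lemma ghz_dotProduct [DecidableEq ι] [Nonempty ι] {u v : Fin 2 → ℂ} (hu : u ⬝ᵥ star u = 1)
    (hv : v ⬝ᵥ star v = 1) (huv : u ⬝ᵥ star v = 0) (hvu : v ⬝ᵥ star u = 0) (c d : ℂ) :
    (((√(1 / 2) : ℝ) : ℂ) • (c • tensorVec (fun _ : ι => u) + d • tensorVec (fun _ => v))) ⬝ᵥ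
      star (ghzVec ι u v) = (c + d) / 2 := by
  simp only [ghzVec, star_smul, star_add, smul_dotProduct, dotProduct_smul, add_dotProduct,
    dotProduct_add, tensorVec_dotProduct_star, hu, hv, huv, hvu, Finset.prod_const,
    Finset.card_univ, one_pow, zero_pow Fintype.card_ne_zero, RCLike.star_def,
    Complex.conj_ofReal, smul_eq_mul]
  linear_combination (c + d) * sqrt_half_mul_self

/-- For a rank-one operator, this identity turns a zero mean of H into ρHρ = 0, and trace 1 into
idempotence. -/
lemma vecMulVec_mul_mul_vecMulVec {κ : Type} [Fintype κ] (ψ : κ → ℂ) (M : Matrix κ κ ℂ) :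
    vecMulVec ψ (star ψ) * M * vecMulVec ψ (star ψ) =
      (vecMulVec ψ (star ψ) * M).trace • vecMulVec ψ (star ψ) := by
  rw [Matrix.vecMulVec_mul, Matrix.vecMulVec_mul_vecMulVec, Matrix.trace_vecMulVec,
    Matrix.vecMulVec_smul, dotProduct_comm]

lemma trace_vecMulVec_star_mul {κ : Type} [Fintype κ] (ψ : κ → ℂ) (M : Matrix κ κ ℂ) :
    (vecMulVec ψ (star ψ) * M).trace = (M *ᵥ ψ) ⬝ᵥ star ψ := by
  rw [Matrix.trace_mul_comm, Matrix.mul_vecMulVec, Matrix.trace_vecMulVec]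

variable {N : ℕ}

lemma localSiteOp_mulVec_tensorVec {A : Finset (Fin N)} {i : Fin N} (hi : i ∈ A)
    {K : Matrix (Fin 2) (Fin 2) ℂ} {u : Fin 2 → ℂ} {a : ℂ} (hu : K *ᵥ u = a • u) :
    localSiteOp A i K *ᵥ tensorVec (fun _ => u) = a • tensorVec (fun _ => u) := by
  rw [localSiteOp, tensorOp_mulVec, ← tensorVec_ite_smul ⟨i, hi⟩ a]
  congr 1
  ext j : 1
  simp only [Subtype.ext_iff]
  split_ifs
  · exact hu
  · exact Matrix.one_mulVec u

/-- The Greenberger-Horne-Zeilinger state of the qubits in `A`. -/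
def ghzState (u v : Fin 2 → ℂ) (A : Finset (Fin N)) : QubitOp A :=
  vecMulVec (ghzVec A u v) (star (ghzVec A u v))

section Eigen

variable {u v : Fin 2 → ℂ} (hu : u ⬝ᵥ star u = 1) (hv : v ⬝ᵥ star v = 1)
  (huv : u ⬝ᵥ star v = 0) (hvu : v ⬝ᵥ star u = 0)
include hu hv huv hvu

lemma trace_ghzState {A : Finset (Fin N)} (hA : A.Nonempty) : (ghzState u v A).trace = 1 := by
  have := hA.to_subtype
  rw [ghzState, Matrix.trace_vecMulVec]
  have := ghz_dotProduct (ι := A) hu hv huv hvu 1 1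
  rw [one_smul, one_smul] at this
  exact this.trans (by norm_num)

lemma ghzState_isDensityMatrix {A : Finset (Fin N)} (hA : A.Nonempty) :
    IsDensityMatrix (ghzState u v A) :=
  ⟨Matrix.posSemidef_vecMulVec_self_star _, trace_ghzState hu hv huv hvu hA⟩

variable {K : Matrix (Fin 2) (Fin 2) ℂ} {a : ℝ} (hKu : K *ᵥ u = (a : ℂ) • u)
  (hKv : K *ᵥ v = (-a : ℂ) • v)
include hKu hKv

lemma trace_ghzState_mul_localSiteOp {A : Finset (Fin N)} {i : Fin N} (hi : i ∈ A) :
    (ghzState u v A * localSiteOp A i K).trace = 0 := by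
  have : Nonempty A := ⟨⟨i, hi⟩⟩
  rw [ghzState, trace_vecMulVec_star_mul]
  conv_lhs => enter [1]; rw [ghzVec, Matrix.mulVec_smul, Matrix.mulVec_add,
    localSiteOp_mulVec_tensorVec hi hKu, localSiteOp_mulVec_tensorVec hi hKv]
  rw [ghz_dotProduct hu hv huv hvu]
  ring

lemma trace_ghzState_mul_localSiteOp_mul {A : Finset (Fin N)} {i j : Fin N} (hi : i ∈ A)
    (hj : j ∈ A) :
    (ghzState u v A * (localSiteOp A i K * localSiteOp A j K)).trace = (a * a : ℝ) := by
  have : Nonempty A := ⟨⟨i, hi⟩⟩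
  rw [ghzState, trace_vecMulVec_star_mul]
  conv_lhs => enter [1]; rw [ghzVec, Matrix.mulVec_smul, Matrix.mulVec_add,
    ← Matrix.mulVec_mulVec, ← Matrix.mulVec_mulVec,
    localSiteOp_mulVec_tensorVec hj hKu, localSiteOp_mulVec_tensorVec hj hKv, Matrix.mulVec_smul,
    Matrix.mulVec_smul, localSiteOp_mulVec_tensorVec hi hKu, localSiteOp_mulVec_tensorVec hi hKv,
    smul_smul, smul_smul]
  rw [ghz_dotProduct hu hv huv hvu]
  push_cast
  ring

end Eigen

lemma partitionTensor_ghzState (Λ : QubitPartition N) (u v : Fin 2 → ℂ) :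
    ∃ ψ : (Fin N → Fin 2) → ℂ, partitionTensor Λ (ghzState u v) = vecMulVec ψ (star ψ) := by
  refine ⟨fun x => ∏ A ∈ Λ.parts, ghzVec A u v fun i => x i, ?_⟩
  ext x y
  simp [partitionTensor, ghzState, Matrix.vecMulVec_apply, Finset.prod_mul_distrib]

/-- The family `σ` is chosen before `Λ`, so that it supplies a separable state for every partition
at once. -/
lemma exists_separable_qfi_ge {n : EuclideanSpace ℝ (Fin 3)} (hn : ‖n‖ = 1) :
    ∃ σ : (A : Finset (Fin N)) → QubitOp A, (∀ A, A.Nonempty → IsDensityMatrix (σ A)) ∧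
      ∀ Λ : QubitPartition N, ((∑ A ∈ Λ.parts, A.card ^ 2 : ℕ) : ℝ) ≤
        qfi (partitionTensor Λ σ) (collectiveSpin N n) := by
  obtain ⟨u, v, a, ha, hu, hv, huv, hvu, hKu, hKv⟩ := exists_spinDir_eigenvectors hn
  have hd : ∀ A : Finset (Fin N), A.Nonempty → IsDensityMatrix (ghzState u v A) :=
    fun A hA => ghzState_isDensityMatrix hu hv huv hvu hA
  refine ⟨ghzState u v, hd, fun Λ => ?_⟩
  have hσ : ∀ A ∈ Λ.parts, IsDensityMatrix (ghzState u v A) :=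
    fun A hA => hd A (Λ.nonempty_of_mem_parts hA)
  have ht := fun A hA => (hσ A hA).2
  have hρ := partitionTensor_isDensityMatrix hσ
  have hmean : ∀ i, (partitionTensor Λ (ghzState u v) * siteOp i (spinDir n)).trace = 0 := by
    intro i
    rw [trace_partitionTensor_mul_siteOp Λ ht]
    exact trace_ghzState_mul_localSiteOp hu hv huv hvu hKu hKv
      (Λ.mem_part_self.2 (Finset.mem_univ i))
  have hcov : ∀ i j, expval (partitionTensor Λ (ghzState u v))
      (siteOp i (spinDir n) * siteOp j (spinDir n)) =
        if Λ.part i = Λ.part j then 1 / 4 else 0 := by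
    intro i j
    split_ifs with h
    · rw [expval, trace_partitionTensor_mul_siteOp_siteOp_same Λ ht h,
        trace_ghzState_mul_localSiteOp_mul hu hv huv hvu hKu hKv
          (Λ.mem_part_self.2 (Finset.mem_univ i)) (h ▸ Λ.mem_part_self.2 (Finset.mem_univ j)),
        Complex.ofReal_re, ha]
    · rw [expval, trace_partitionTensor_mul_siteOp_siteOp_ne Λ ht h, hmean, zero_mul,
        Complex.zero_re]
  have hpure : ∀ M, partitionTensor Λ (ghzState u v) * M * partitionTensor Λ (ghzState u v) =
      (partitionTensor Λ (ghzState u v) * M).trace • partitionTensor Λ (ghzState u v) := by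
    obtain ⟨ψ, hψ⟩ := partitionTensor_ghzState Λ u v
    rw [hψ]
    exact vecMulVec_mul_mul_vecMulVec ψ
  have hproj := hpure 1
  rw [Matrix.mul_one, hρ.2, one_smul] at hproj
  have h0 : partitionTensor Λ (ghzState u v) * collectiveSpin N n *
      partitionTensor Λ (ghzState u v) = 0 := by
    rw [hpure, collectiveSpin_eq_sum, Matrix.mul_sum, Matrix.trace_sum,
      Finset.sum_eq_zero fun i _ => hmean i, zero_smul]
  refine le_trans (le_of_eq ?_)
    (four_mul_expval_sq_le_qfi hρ.1 hproj (collectiveSpin_isHermitian N n) h0)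
  rw [collectiveSpin_eq_sum, Finset.sum_mul_sum]
  simp only [expval_sum, hcov]
  rw [sum_ite_part_eq]
  ring

lemma exists_hasDysonRankLE_qfi_eq {r : ℤ} (hr : -((N : ℤ) - 1) ≤ r)
    {n : EuclideanSpace ℝ (Fin 3)} (hn : ‖n‖ = 1) :
    ∃ ρ : QubitOp (Fin N), HasDysonRankLE r ρ ∧ qfi ρ (collectiveSpin N n) = rankBound N r := by
  classical
  obtain ⟨Λ, hΛ, h⟩ := Finset.exists_mem_eq_sup (rankPartitions N r)
    (rankPartitions_nonempty hr) fun Λ => ∑ A ∈ Λ.parts, A.card ^ 2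
  obtain ⟨σ, hσ, hq⟩ := exists_separable_qfi_ge (N := N) hn
  have hρ : HasDysonRankLE r (partitionTensor Λ σ) := by
    -- All weight sits on the maximizing `Λ`, but partitions of weight zero must also be assigned
    -- separable states.
    refine ⟨Pi.single Λ 1, fun Λ' => partitionTensor Λ' σ, fun Λ' _ => ?_, ?_, fun Λ' _ => ?_, ?_⟩
    · rw [Pi.single_apply]
      split_ifs <;> norm_num
    · rw [Finset.sum_pi_single', if_pos hΛ]
    · exact ⟨1, fun _ => 1, fun _ => σ, by simp, by simp,
        fun _ A hA => hσ A (Λ'.nonempty_of_mem_parts hA), by simp⟩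
    · rw [Finset.sum_eq_single_of_mem Λ hΛ fun Λ' _ hne => by simp [hne]]
      simp
  refine ⟨_, hρ, le_antisymm (hρ.qfi_le hn) ?_⟩
  rw [rankBound, h]
  exact hq Λ

end Attainment

theorem mainTheorem5 (N : ℕ) (hN : 1 ≤ N) (r : ℤ) (hr : -((N : ℤ) - 1) ≤ r)
    (n : EuclideanSpace ℝ (Fin 3)) (hn : ‖n‖ = 1) :
    IsGreatest
      ((fun ρ : QubitOp (Fin N) => qfi ρ (collectiveSpin N n)) '' {ρ | HasDysonRankLE r ρ})
      (rankBound N r : ℝ) ∧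
    (r ≠ 4 - (N : ℤ) → ∀ ρ : QubitOp (Fin N), HasDysonRankLE r ρ →
      qfi ρ (collectiveSpin N n) ≤ ((N : ℝ) + (r : ℝ)) ^ 2 / 4 - 1 / 4 + (N : ℝ)) ∧
    (r = 4 - (N : ℤ) → ∀ ρ : QubitOp (Fin N), HasDysonRankLE r ρ →
      qfi ρ (collectiveSpin N n) ≤ (N : ℝ) + 4) := by
  refine ⟨⟨exists_hasDysonRankLE_qfi_eq hr hn, ?_⟩,
    fun h ρ hρ => (hρ.qfi_le hn).trans ((rankBound_le hN hr).1 h),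
    fun h ρ hρ => (hρ.qfi_le hn).trans ((rankBound_le hN hr).2 h)⟩
  rintro _ ⟨ρ, hρ, rfl⟩
  exact hρ.qfi_le hn

end
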